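/- Let $\mathrm{d}\zeta$ be an arbitrary complex-valued measure on $\mathbb{C}\times\mathbb{C}$ (of the form $\mathrm{d}\zeta=w\,\mathrm{d}\mu$ with $\mu$ a positive Borel measure and $w$ a measurable complex density) and $D\subseteq\mathbb{C}\times\mathbb{C}$ an arbitrary measurable integration domain. For $n\in\mathbb{Z}$ and real variables $x=(x_1,x_{-1})$ put $$\rho_n(k)=\mathrm{e}^{kx_1+k^{-1}x_{-1}}k^n,\qquad \sigma_n(k')=\mathrm{e}^{k'x_1+k'^{-1}x_{-1}}(-k')^{-n},\qquad \Omega(k,k')=\frac1{k+k'},$$ and let $\boldsymbol{c}(k)=(k^i)_{i\in\mathbb{Z}}$ be an infinite column vector. Let $E\subseteq\mathbb{C}\setminus\{0\}$ be a set of spectral parameters containing the first components of all points of $D$, such that $l'\ne0$ for $\zeta$-almost every $(l,l')\in D$, and, for each $k\in E$, $k+l'\neq0$ for $\zeta$-almost every $(l,l')\in D$ (that is, for $\mu$-almost every such point), and let $X\subseteq\mathbb{R}^2$ be open. Consider the linear integral equation $$\boldsymbol{u}_n(k)+\iint_D\mathrm{d}\zeta(l,l')\,\rho_n(k)\Omega(k,l')\sigma_n(l')\boldsymbol{u}_n(l)=\rho_n(k)\boldsymbol{c}(k),\qquad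 n\in\mathbb{Z},\ x\in X,\ k\in E,$$ and assume that for all $n\in\mathbb{Z}$ and $x\in X$ the corresponding homogeneous scalar equation has only the zero solution on $E$ (among functions for which the integral converges absolutely for every $k\in E$). Let $\boldsymbol{u}_n(k)=(u_n^{(i)}(k))_{i\in\mathbb{Z}}$ be any solution, with absolutely convergent integrals, whose components are differentiable in $x\in X$ and such that, locally in $x$, each component and its first derivative in $x$ are dominated by a function $b(k)$ on $E$ (depending on $n$, $i$ and the neighbourhood, but not on $x$) for which the integrals $\iint_D\mathrm{d}\zeta(l,l')\,\rho_n(k)\Omega(k,l')\sigma_n(l')b(l)$, $k\in E$, and $\iint_D\mathrm{d}\zeta(k,k')\,b(k)k'^j\sigma_n(k')$, $j\in\mathbb{Z}$, converge absolutely for all $x$ in the neighbourhood. Define the infinite matrix $$\boldsymbol{U}_n=\iint_D\mathrm{d}\zeta(k,k')\,\boldsymbol{u}_n(k)\,{}^t\boldsymbol{c}(k')\,\sigma_n(k').$$ Then $1-\boldsymbol{U}_n^{(0,-1)}\neq0$ on $X$ for every $n\in\mathbb{Z}$. Hence, near every point of $X$, there are continuous branches $\varphi_n=\ln\bigl(1-\boldsymbol{U}_n^{(0,-1)}\bigr)$,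 $n\in\mathbb{Z}$. For any such branches near a point of $X$ (on neighbourhoods which may depend on $n$), the functions $\varphi_n$ are twice continuously differentiable near that point and satisfy at that point the two-dimensional Toda lattice equation of $A_\infty$-type $$\partial_1\partial_{-1}\varphi_n=\mathrm{e}^{\varphi_n-\varphi_{n-1}}-\mathrm{e}^{\varphi_{n+1}-\varphi_n},\qquad n\in\mathbb{Z}.$$ Moreover, for every $k\in E$, the wave functions $\phi_n=[\boldsymbol{u}_n(k)]^{(0)}$, collected in the infinite vector $\Phi={}^t(\dots,\phi_{-1},\phi_0,\phi_1,\dots)$, satisfy the linear problem (Lax pair) $$\partial_1\Phi=\boldsymbol{P}\Phi,\qquad \partial_{-1}\Phi=\boldsymbol{Q}\Phi$$ at that point, where $\boldsymbol{P}$ and $\boldsymbol{Q}$ are the $\mathbb{Z}\times\mathbb{Z}$ matrices whose only nonzero entries are $\boldsymbol{P}_{n,n}=\partial_1\varphi_n$, $\boldsymbol{P}_{n,n+1}=1$ and $\boldsymbol{Q}_{n,n-1}=\mathrm{e}^{-\theta_n}$ with $\theta_n=\varphi_{n-1}-\varphi_n$; that is, $\partial_1\phi_n=(\partial_1\varphi_n)\phi_n+\phi_{n+1}$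 and $\partial_{-1}\phi_n=\mathrm{e}^{\varphi_n-\varphi_{n-1}}\phi_{n-1}$. -/

import Mathlib

open MeasureTheory Filter Topology

noncomputable section

namespace Toda

/-- A complex-valued integration measure `dζ = w dμ` on pairs of spectral parameters, with `μ` an
arbitrary positive Borel measure on `ℂ × ℂ` and `w` an arbitrary measurable complex density,
together with an arbitrary measurable integration domain `D`. -/
structure SpectralMeasure where
  μ : Measure (ℂ × ℂ)
  w : ℂ × ℂ → ℂ
  D : Set (ℂ × ℂ)
  measurable_w : Measurable w
  measurableSet_D : MeasurableSet D

/-- The integral `∬_D dζ(l, m) f(l, m)`. -/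
def SpectralMeasure.integral (Z : SpectralMeasure) (f : ℂ × ℂ → ℂ) : ℂ :=
  ∫ p in Z.D, Z.w p * f p ∂Z.μ

/-- The integral `∬_D dζ(l, m) f(l, m)` converges (absolutely). -/
def SpectralMeasure.Converges (Z : SpectralMeasure) (f : ℂ × ℂ → ℂ) : Prop :=
  IntegrableOn (fun p => Z.w p * f p) Z.D Z.μ

/-- A point `x : ℝ × ℝ` stands for the pair of times: `x.1` is `x_1` and `x.2` is `x_{-1}`.
The plane wave factor `ρ_n(k)`. -/
def rho (n : ℤ) (x : ℝ × ℝ) (k : ℂ) : ℂ :=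
  Complex.exp (k * (x.1 : ℂ) + k⁻¹ * (x.2 : ℂ)) * k ^ n

/-- The plane wave factor `σ_n(m)`. -/
def sigma (n : ℤ) (x : ℝ × ℝ) (m : ℂ) : ℂ :=
  Complex.exp (m * (x.1 : ℂ) + m⁻¹ * (x.2 : ℂ)) * (-m) ^ (-n)

/-- The Cauchy kernel. -/
def Omega (k m : ℂ) : ℂ := 1 / (k + m)

/-- The infinite vector of monomials. -/
def c (k : ℂ) : ℤ → ℂ := fun i => k ^ i

/-- The integrand `ρ_n(k) Ω(k, m) σ_n(m) f(l)` of the linear integral equation, as a function of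
`p = (l, m)`. -/
def integrand (n : ℤ) (x : ℝ × ℝ) (f : ℂ → ℂ) (k : ℂ) : ℂ × ℂ → ℂ :=
  fun p => rho n x k * Omega k p.2 * sigma n x p.2 * f p.1

/-- `E` is a set of values of the spectral parameter `k` on which the linear integral equation can
be considered: it contains the first components of the points of `D`, and the plane wave factors
and the kernel are defined there, up to null sets in the integration variables. -/
structure IsSpectralSet (Z : SpectralMeasure) (E : Set ℂ) : Prop where
  fst_mem : ∀ p ∈ Z.D, p.1 ∈ E
  ne_zero : ∀ k ∈ E, k ≠ 0
  snd_ne_zero : ∀ᵐ p ∂(Z.μ.restrict Z.D), p.2 ≠ 0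
  add_ne_zero : ∀ k ∈ E, ∀ᵐ p ∂(Z.μ.restrict Z.D), k + p.2 ≠ 0

/-- The homogeneous linear integral equation has only the zero solution. -/
def HomogeneousTrivial (Z : SpectralMeasure) (E : Set ℂ) (n : ℤ) (x : ℝ × ℝ) : Prop :=
  ∀ f : ℂ → ℂ, (∀ k ∈ E, Z.Converges (integrand n x f k)) →
    (∀ k ∈ E, f k + Z.integral (integrand n x f k) = 0) → ∀ k ∈ E, f k = 0

/-- The family of infinite vectors `u n x k` (with components `u n x k i`, `i : ℤ`) solves the
linear integral equation for all `n`, all times in `X` and all `k` in `E`. -/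
structure IsSolution (Z : SpectralMeasure) (E : Set ℂ) (X : Set (ℝ × ℝ))
    (u : ℤ → ℝ × ℝ → ℂ → ℤ → ℂ) : Prop where
  converges : ∀ n, ∀ x ∈ X, ∀ k ∈ E, ∀ i, Z.Converges (integrand n x (fun l => u n x l i) k)
  equation : ∀ n, ∀ x ∈ X, ∀ k ∈ E, ∀ i,
    u n x k i + Z.integral (integrand n x (fun l => u n x l i) k) = rho n x k * c k i

/-- The components of the solution are differentiable functions of the times and, locally in the
times, they and their derivatives are dominated by a function of `k` for which the integrals in
the linear integral equation and in the potential converge. -/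
structure IsRegular (Z : SpectralMeasure) (E : Set ℂ) (X : Set (ℝ × ℝ))
    (u : ℤ → ℝ × ℝ → ℂ → ℤ → ℂ) : Prop where
  differentiable : ∀ n, ∀ k ∈ E, ∀ i, DifferentiableOn ℝ (fun x => u n x k i) X
  dominated : ∀ n i, ∀ x₀ ∈ X, ∃ N ∈ 𝓝 x₀, ∃ b : ℂ → ℝ,
    (∀ x ∈ N, ∀ k ∈ E, ‖u n x k i‖ ≤ b k ∧ ‖fderiv ℝ (fun y => u n y k i) x‖ ≤ b k) ∧
    (∀ x ∈ N, ∀ k ∈ E, Z.Converges (integrand n x (fun l => (b l : ℂ)) k)) ∧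
    (∀ x ∈ N, ∀ j : ℤ, Z.Converges (fun p => (b p.1 : ℂ) * c p.2 j * sigma n x p.2))

/-- The infinite matrix `U_n = ∬_D dζ(k, m) u_n(k) ᵗc(m) σ_n(m)`. -/
def potential (Z : SpectralMeasure) (u : ℤ → ℝ × ℝ → ℂ → ℤ → ℂ) (n : ℤ) (x : ℝ × ℝ) :
    Matrix ℤ ℤ ℂ :=
  fun i j => Z.integral (fun p => u n x p.1 i * c p.2 j * sigma n x p.2)

/-- The partial derivative with respect to `x_1`. -/
def partialOne (f : ℝ × ℝ → ℂ) (x : ℝ × ℝ) : ℂ := deriv (fun s => f (s, x.2)) x.1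

/-- The partial derivative with respect to `x_{-1}`. -/
def partialNegOne (f : ℝ × ℝ → ℂ) (x : ℝ × ℝ) : ℂ := deriv (fun s => f (x.1, s)) x.2

/-- Near `x`, the function `f` is a continuous branch of the logarithm of `g`. -/
def IsLogNear (g f : ℝ × ℝ → ℂ) (x : ℝ × ℝ) : Prop :=
  ∀ᶠ y in 𝓝 x, ContinuousAt f y ∧ Complex.exp (f y) = g y

/-- The product of an infinite matrix and an infinite column vector. -/
def infMulVec (M : Matrix ℤ ℤ ℂ) (v : ℤ → ℂ) : ℤ → ℂ := fun i => ∑' j, M i j * v j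

/-- `θ_n = φ_{n-1} - φ_n`. -/
def theta (φ : ℤ → ℝ × ℝ → ℂ) (n : ℤ) (x : ℝ × ℝ) : ℂ := φ (n - 1) x - φ n x

/-- The Lax matrix `P`: diagonal entries `∂_1 φ_n`, entries `1` just above the diagonal. -/
def laxP (φ : ℤ → ℝ × ℝ → ℂ) (x : ℝ × ℝ) : Matrix ℤ ℤ ℂ :=
  fun n m => if m = n then partialOne (φ n) x else if m = n + 1 then 1 else 0

/-- The Lax matrix `Q`: entries `exp (-θ_n)` just below the diagonal, in row `n`. -/
def laxQ (φ : ℤ → ℝ × ℝ → ℂ) (x : ℝ × ℝ) : Matrix ℤ ℤ ℂ :=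
  fun n m => if m = n - 1 then Complex.exp (-theta φ n x) else 0

end Toda

end

/-! The kernel satisfies `(k + m) Ω(k, m) = 1`. Shifting `n` or differentiating in a time therefore
changes `ρ_n Ω σ_n` only by rank-one terms, whose integrals are entries of `U`. So `u_{n+1}` and the
derivatives of `u_n` again solve the level-`n` equation, with explicit sources, and uniqueness
(`Solves.unique`) turns this into linear relations among components of `u_n`: `solution_shift` and
`hasFDerivAt_solution`. Integrating against `c_j σ_n` gives closed relations among the entries of
`U`: `potential_shift` and `hasFDerivAt_potential`.

Write `v_n = 1 - U_n^{(0,-1)}`. The shift relation at `(-1,-1)` says `v_n (1 - U_{n+1}^{(-1,0)}) =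
1`, whence nonvanishing. The flows give `∂_1 ln v_n = U_{n+1}^{(0,0)} - U_n^{(0,0)}` and `∂_{-1} ln
v_n = U_{n+1}^{(-1,-1)} - U_n^{(-1,-1)}`, while `∂_1 U_n^{(-1,-1)} = 1 - v_n / v_{n-1}`; together
these are the Toda equation. The Lax pair combines the flows of `u_n^{(0)}` with the shift relations
for `i = 0` and `i = -1`. -/

namespace Toda

/-! ### Linearity of the spectral integral -/

namespace SpectralMeasure

variable {Z : SpectralMeasure} {f g : ℂ × ℂ → ℂ}

theorem Converges.add (hf : Z.Converges f) (hg : Z.Converges g) :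
    Z.Converges (fun p => f p + g p) := by
  have := Integrable.add hf hg
  refine this.congr (ae_of_all _ fun p => ?_)
  simp [mul_add]

theorem Converges.const_mul (hf : Z.Converges f) (a : ℂ) : Z.Converges (fun p => a * f p) := by
  have := Integrable.const_mul hf a
  refine this.congr (ae_of_all _ fun p => ?_)
  simp only; ring

theorem Converges.sub (hf : Z.Converges f) (hg : Z.Converges g) :
    Z.Converges (fun p => f p - g p) := by
  have := Integrable.sub hf hg
  refine this.congr (ae_of_all _ fun p => ?_)
  simp [mul_sub]

theorem Converges.congr (hf : Z.Converges f) (h : ∀ᵐ p ∂(Z.μ.restrict Z.D), f p = g p) :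
    Z.Converges g := by
  refine Integrable.congr hf ?_
  filter_upwards [h] with p hp
  rw [hp]

theorem integral_add (hf : Z.Converges f) (hg : Z.Converges g) :
    Z.integral (fun p => f p + g p) = Z.integral f + Z.integral g := by
  simp only [integral, mul_add]
  exact MeasureTheory.integral_add hf hg

theorem integral_sub (hf : Z.Converges f) (hg : Z.Converges g) :
    Z.integral (fun p => f p - g p) = Z.integral f - Z.integral g := by
  simp only [integral, mul_sub]
  exact MeasureTheory.integral_sub hf hg

theorem integral_const_mul (a : ℂ) : Z.integral (fun p => a * f p) = a * Z.integral f := by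
  simp only [integral, mul_left_comm _ a]
  exact MeasureTheory.integral_const_mul a _

theorem integral_congr (h : ∀ᵐ p ∂(Z.μ.restrict Z.D), f p = g p) :
    Z.integral f = Z.integral g := by
  refine integral_congr_ae ?_
  filter_upwards [h] with p hp
  rw [hp]

theorem ae_mem (Z : SpectralMeasure) : ∀ᵐ p ∂(Z.μ.restrict Z.D), p ∈ Z.D :=
  ae_restrict_mem Z.measurableSet_D

/-- Domination of an integrand in its first variable. -/
theorem Converges.mono {f : ℂ → ℂ} {b : ℂ → ℝ} {h : ℂ → ℂ}
    (hf : AEStronglyMeasurable (fun p => Z.w p * f p.1) (Z.μ.restrict Z.D)) (hh : Measurable h)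
    (hb : ∀ p ∈ Z.D, ‖f p.1‖ ≤ b p.1) (hc : Z.Converges (fun p => (b p.1 : ℂ) * h p.2)) :
    Z.Converges (fun p => f p.1 * h p.2) := by
  refine Integrable.mono hc ?_ ?_
  · have := hf.mul (hh.comp measurable_snd).aestronglyMeasurable
    refine this.congr (ae_of_all _ fun p => ?_)
    simp [mul_assoc]
  · filter_upwards [Z.ae_mem] with p hp
    simp only [norm_mul, Complex.norm_real]
    gcongr
    exact (hb p hp).trans (le_abs_self _)

end SpectralMeasure

/-! ### Real-linear maps and exponentials on the plane of times -/

/-- The real-linear map `v ↦ a v₁ + b v₂`. -/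
noncomputable def comb (a b : ℂ) : ℝ × ℝ →L[ℝ] ℂ :=
  a • (Complex.ofRealCLM.comp (ContinuousLinearMap.fst ℝ ℝ ℝ)) +
    b • (Complex.ofRealCLM.comp (ContinuousLinearMap.snd ℝ ℝ ℝ))

@[simp]
theorem comb_apply (a b : ℂ) (v : ℝ × ℝ) : comb a b v = a * (v.1 : ℂ) + b * (v.2 : ℂ) := by
  simp [comb]

theorem eq_comb (T : ℝ × ℝ →L[ℝ] ℂ) : T = comb (T (1, 0)) (T (0, 1)) := by
  ext <;> simp

theorem norm_comb_le (a b : ℂ) : ‖comb a b‖ ≤ ‖a‖ + ‖b‖ := by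
  refine ContinuousLinearMap.opNorm_le_bound _ (by positivity) fun v => ?_
  rw [comb_apply]
  refine (norm_add_le _ _).trans ?_
  simp only [norm_mul, Complex.norm_real, add_mul]
  gcongr
  · exact norm_fst_le v
  · exact norm_snd_le v

/-- The exponential factor common to `rho` and `sigma`. -/
noncomputable def wave (x : ℝ × ℝ) (m : ℂ) : ℂ := Complex.exp (comb m m⁻¹ x)

theorem wave_ne_zero (x : ℝ × ℝ) (m : ℂ) : wave x m ≠ 0 := Complex.exp_ne_zero _

theorem measurable_wave (x : ℝ × ℝ) : Measurable (wave x) := by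
  unfold wave
  simp only [comb_apply]
  fun_prop

theorem hasFDerivAt_wave (x : ℝ × ℝ) (m : ℂ) :
    HasFDerivAt (fun y => wave y m) (wave x m • comb m m⁻¹) x :=
  (comb m m⁻¹).hasFDerivAt.cexp

theorem norm_wave (x : ℝ × ℝ) (m : ℂ) :
    ‖wave x m‖ = Real.exp (m.re * x.1) * Real.exp ((m⁻¹).re * x.2) := by
  rw [wave, Complex.norm_exp, ← Real.exp_add]
  simp

/-- Monotonicity puts the maximum at an endpoint; summing both endpoints gives a bound independent
of the sign of `a`, which varies with the spectral parameter. -/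
theorem exp_mul_le_add {t y r : ℝ} (a : ℝ) (h : |t - y| ≤ r) :
    Real.exp (a * t) ≤ Real.exp (a * (y + r)) + Real.exp (a * (y - r)) := by
  obtain ⟨h1, h2⟩ := abs_le.1 h
  rcases le_total 0 a with ha | ha
  · have : Real.exp (a * t) ≤ Real.exp (a * (y + r)) :=
      Real.exp_le_exp.2 (mul_le_mul_of_nonneg_left (by linarith) ha)
    linarith [Real.exp_pos (a * (y - r))]
  · have : Real.exp (a * t) ≤ Real.exp (a * (y - r)) :=
      Real.exp_le_exp.2 (mul_le_mul_of_nonpos_left (by linarith) ha)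
    linarith [Real.exp_pos (a * (y + r))]

/-- On a box the exponential factor is dominated by its values at the corners. -/
theorem norm_wave_le {x y : ℝ × ℝ} {r : ℝ} (m : ℂ) (h : dist x y ≤ r) :
    ‖wave x m‖ ≤ ‖wave (y.1 + r, y.2 + r) m‖ + ‖wave (y.1 + r, y.2 - r) m‖ +
      ‖wave (y.1 - r, y.2 + r) m‖ + ‖wave (y.1 - r, y.2 - r) m‖ := by
  rw [Prod.dist_eq, max_le_iff, Real.dist_eq, Real.dist_eq] at h
  have h1 := exp_mul_le_add m.re h.1
  have h2 := exp_mul_le_add (m⁻¹).re h.2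
  simp only [norm_wave]
  refine (mul_le_mul h1 h2 (Real.exp_pos _).le (by positivity)).trans (le_of_eq ?_)
  ring

/-! ### Differentiation under the spectral integral -/

/-- The derivative at a point of a family of measurable functions is measurable. -/
theorem aestronglyMeasurable_of_hasFDerivAt {α : Type*} [MeasurableSpace α] {μ : Measure α}
    {F : ℝ × ℝ → α → ℂ} {F' : α → ℝ × ℝ →L[ℝ] ℂ} {x₀ : ℝ × ℝ}
    (hF : ∀ᶠ x in 𝓝 x₀, AEStronglyMeasurable (F x) μ)
    (h : ∀ᵐ a ∂μ, HasFDerivAt (fun x => F x a) (F' a) x₀) : AEStronglyMeasurable F' μ := by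
  have key : ∀ v, AEStronglyMeasurable (fun a => F' a v) μ := by
    intro v
    have hc : Tendsto (fun n : ℕ => x₀ + ((n : ℝ))⁻¹ • v) atTop (𝓝 x₀) := by
      have : Tendsto (fun n : ℕ => x₀ + ((n : ℝ))⁻¹ • v) atTop (𝓝 (x₀ + (0 : ℝ) • v)) :=
        tendsto_const_nhds.add
          ((tendsto_inv_atTop_zero.comp tendsto_natCast_atTop_atTop).smul_const v)
      simpa using this
    -- Measurability is known only near `x₀`, so the sequence of difference quotients starts at `N`.
    obtain ⟨N, hN⟩ := eventually_atTop.1 (hc.eventually hF)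
    refine aestronglyMeasurable_of_tendsto_ae atTop
      (f := fun n a => ((n + N : ℕ) : ℝ) • (F (x₀ + (((n + N : ℕ) : ℝ))⁻¹ • v) a - F x₀ a))
      (fun n => ?_) ?_
    · have := ((hN (n + N) (Nat.le_add_left _ _)).sub hF.self_of_nhds).const_smul
        (((n + N : ℕ) : ℝ))
      exact this
    filter_upwards [h] with a ha
    refine ha.lim v (c := fun n : ℕ => ((n + N : ℕ) : ℝ)) ?_
    refine tendsto_norm_atTop_atTop.comp (tendsto_natCast_atTop_atTop.comp ?_)
    exact tendsto_add_atTop_nat N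
  have : F' = fun a => comb (F' a (1, 0)) (F' a (0, 1)) := funext fun a => eq_comb _
  rw [this]
  exact ((key _).smul_const _).add ((key _).smul_const _)

/-- Differentiation under the spectral integral sign. -/
theorem hasFDerivAt_integral_wave {Z : SpectralMeasure} {E : Set ℂ} (hE : ∀ p ∈ Z.D, p.1 ∈ E)
    {f : ℝ × ℝ → ℂ → ℂ} {h : ℂ → ℂ} (hh : Measurable h) {x₀ : ℝ × ℝ} {s : Set (ℝ × ℝ)}
    (hs : s ∈ 𝓝 x₀) {b : ℂ → ℝ}
    (hmeas : ∀ x ∈ s, AEStronglyMeasurable (fun p => Z.w p * f x p.1) (Z.μ.restrict Z.D))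
    (hdiff : ∀ x ∈ s, ∀ k ∈ E, DifferentiableAt ℝ (fun y => f y k) x)
    (hb : ∀ x ∈ s, ∀ k ∈ E, ‖f x k‖ ≤ b k ∧ ‖fderiv ℝ (fun y => f y k) x‖ ≤ b k)
    (hc : ∀ x ∈ s, Z.Converges (fun p => (b p.1 : ℂ) * (h p.2 * wave x p.2)) ∧
      Z.Converges (fun p => (b p.1 : ℂ) * (h p.2 * p.2 * wave x p.2)) ∧
      Z.Converges (fun p => (b p.1 : ℂ) * (h p.2 * p.2⁻¹ * wave x p.2))) :
    (∀ v, AEStronglyMeasurable (fun p => Z.w p * fderiv ℝ (fun y => f y p.1) x₀ v)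
      (Z.μ.restrict Z.D)) ∧
    ∃ T : ℝ × ℝ →L[ℝ] ℂ,
      HasFDerivAt (fun x => Z.integral (fun p => f x p.1 * (h p.2 * wave x p.2))) T x₀ ∧
      ∀ v, T v = Z.integral (fun p =>
        (fderiv ℝ (fun y => f y p.1) x₀ v + f x₀ p.1 * comb p.2 p.2⁻¹ v) *
          (h p.2 * wave x₀ p.2)) := by
  obtain ⟨r, hr, hrs⟩ := Metric.nhds_basis_closedBall.mem_iff.1 hs
  have hx₀ : x₀ ∈ s := mem_of_mem_nhds hs
  have hev : ∀ᶠ x in 𝓝 x₀, x ∈ s := hs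
  set F : ℝ × ℝ → ℂ × ℂ → ℂ := fun x p => Z.w p * (f x p.1 * (h p.2 * wave x p.2)) with hF
  set F' : ℝ × ℝ → ℂ × ℂ → ℝ × ℝ →L[ℝ] ℂ := fun x p => (Z.w p * (h p.2 * wave x p.2)) •
    (fderiv ℝ (fun y => f y p.1) x + f x p.1 • comb p.2 p.2⁻¹) with hF'
  -- The three terms bound the derivative of `f` and the factors `m`, `m⁻¹` produced by
  -- differentiating the exponential.
  set B : ℝ × ℝ → ℂ × ℂ → ℝ := fun y p => ‖Z.w p * ((b p.1 : ℂ) * (h p.2 * wave y p.2))‖ +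
    ‖Z.w p * ((b p.1 : ℂ) * (h p.2 * p.2 * wave y p.2))‖ +
    ‖Z.w p * ((b p.1 : ℂ) * (h p.2 * p.2⁻¹ * wave y p.2))‖ with hB
  have hBi : ∀ y ∈ s, Integrable (B y) (Z.μ.restrict Z.D) := fun y hy =>
    ((hc y hy).1.norm.add (hc y hy).2.1.norm).add (hc y hy).2.2.norm
  have hFm : ∀ x ∈ s, AEStronglyMeasurable (F x) (Z.μ.restrict Z.D) := by
    intro x hx
    have := (hmeas x hx).mul
      ((hh.mul (measurable_wave x)).comp measurable_snd).aestronglyMeasurable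
    refine this.congr (ae_of_all _ fun p => ?_)
    simp [hF, mul_assoc]
  have hFd : ∀ᵐ p ∂(Z.μ.restrict Z.D), ∀ x ∈ s,
      HasFDerivAt (fun x => F x p) (F' x p) x := by
    filter_upwards [Z.ae_mem] with p hp x hx
    have h1 := (hdiff x hx _ (hE p hp)).hasFDerivAt
    have h2 := ((h1.mul ((hasFDerivAt_wave x p.2).const_mul (h p.2))).const_mul (Z.w p))
    refine h2.congr_fderiv ?_
    ext <;> simp [hF'] <;> ring
  have hF'm : AEStronglyMeasurable (F' x₀) (Z.μ.restrict Z.D) :=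
    aestronglyMeasurable_of_hasFDerivAt (hev.mono hFm) (hFd.mono fun p hp => hp x₀ hx₀)
  have hFi : Integrable (F x₀) (Z.μ.restrict Z.D) :=
    SpectralMeasure.Converges.mono (h := fun m => h m * wave x₀ m) (hmeas x₀ hx₀)
      (hh.mul (measurable_wave x₀)) (fun p hp => (hb x₀ hx₀ _ (hE p hp)).1) (hc x₀ hx₀).1
  have hBeq : ∀ y p, B y p = ‖Z.w p‖ * ‖h p.2‖ * |b p.1| * (1 + ‖p.2‖ + ‖p.2⁻¹‖) *
      ‖wave y p.2‖ := by
    intro y p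
    simp only [hB, norm_mul, Complex.norm_real, Real.norm_eq_abs]
    ring
  -- A sup-norm ball is a square, so the sum of `B` over its four corners is a dominating function
  -- independent of `x`.
  have hF'b : ∀ᵐ p ∂(Z.μ.restrict Z.D), ∀ x ∈ Metric.closedBall x₀ r, ‖F' x p‖ ≤
      B (x₀.1 + r, x₀.2 + r) p + B (x₀.1 + r, x₀.2 - r) p + B (x₀.1 - r, x₀.2 + r) p +
        B (x₀.1 - r, x₀.2 - r) p := by
    filter_upwards [Z.ae_mem] with p hp x hx
    obtain ⟨hb1, hb2⟩ := hb x (hrs hx) _ (hE p hp)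
    have hw := norm_wave_le p.2 (Metric.mem_closedBall.1 hx)
    have h1 : ‖fderiv ℝ (fun y => f y p.1) x + f x p.1 • comb p.2 p.2⁻¹‖ ≤
        |b p.1| * (1 + ‖p.2‖ + ‖p.2⁻¹‖) := by
      refine (norm_add_le _ _).trans ?_
      rw [norm_smul, add_assoc, mul_add, mul_one]
      gcongr
      · exact hb2.trans (le_abs_self _)
      · exact hb1.trans (le_abs_self _)
      · exact norm_comb_le _ _
    simp only [hBeq, hF', norm_smul, norm_mul, ← mul_add]
    calc _ ≤ ‖Z.w p‖ * (‖h p.2‖ * ‖wave x p.2‖) * (|b p.1| * (1 + ‖p.2‖ + ‖p.2⁻¹‖)) := by gcongr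
      _ = ‖Z.w p‖ * ‖h p.2‖ * |b p.1| * (1 + ‖p.2‖ + ‖p.2⁻¹‖) * ‖wave x p.2‖ := by ring
      _ ≤ _ := by gcongr
  have hcorner : ∀ y : ℝ × ℝ, |y.1 - x₀.1| ≤ r → |y.2 - x₀.2| ≤ r → y ∈ s := fun y h1 h2 =>
    hrs (by rw [Metric.mem_closedBall, Prod.dist_eq, Real.dist_eq, Real.dist_eq]; exact max_le h1 h2)
  have hbi : Integrable (fun p => B (x₀.1 + r, x₀.2 + r) p + B (x₀.1 + r, x₀.2 - r) p +
      B (x₀.1 - r, x₀.2 + r) p + B (x₀.1 - r, x₀.2 - r) p) (Z.μ.restrict Z.D) := by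
    refine (((hBi _ ?_).add (hBi _ ?_)).add (hBi _ ?_)).add (hBi _ ?_) <;>
      exact hcorner _ (by simp [abs_of_pos hr]) (by simp [abs_of_pos hr])
  have hmem : Metric.closedBall x₀ r ∈ 𝓝 x₀ := Metric.closedBall_mem_nhds x₀ hr
  refine ⟨fun v => ?_, ∫ p, F' x₀ p ∂(Z.μ.restrict Z.D), ?_, fun v => ?_⟩
  · have h1 : AEStronglyMeasurable
        (fun p => Z.w p • fderiv ℝ (fun y => f y p.1) x₀) (Z.μ.restrict Z.D) := by
      refine aestronglyMeasurable_of_hasFDerivAt (x₀ := x₀) (F := fun x p => Z.w p * f x p.1)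
        (hev.mono hmeas) ?_
      filter_upwards [Z.ae_mem] with p hp
      exact (hdiff x₀ hx₀ _ (hE p hp)).hasFDerivAt.const_mul _
    exact h1.apply_continuousLinearMap v
  · exact hasFDerivAt_integral_of_dominated_of_fderiv_le hmem (hev.mono hFm) hFi hF'm hF'b hbi
      (hFd.mono fun p hp x hx => hp x (hrs hx))
  · have hF'i : Integrable (F' x₀) (Z.μ.restrict Z.D) :=
      hbi.mono' hF'm (hF'b.mono fun p hp => hp x₀ (Metric.mem_closedBall_self hr.le))
    rw [ContinuousLinearMap.integral_apply hF'i]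
    refine integral_congr_ae (ae_of_all _ fun p => ?_)
    simp only [hF', smul_apply, add_apply, smul_eq_mul]
    ring

/-! ### Algebra of the plane wave factors -/

open SpectralMeasure

theorem sigma_eq (n : ℤ) (x : ℝ × ℝ) (m : ℂ) : sigma n x m = (-m) ^ (-n) * wave x m := by
  simp [sigma, wave, mul_comm]

theorem rho_eq (n : ℤ) (x : ℝ × ℝ) (k : ℂ) : rho n x k = wave x k * k ^ n := by
  simp [rho, wave]

theorem rho_ne_zero {n : ℤ} {x : ℝ × ℝ} {k : ℂ} (hk : k ≠ 0) : rho n x k ≠ 0 := by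
  rw [rho_eq]; exact mul_ne_zero (wave_ne_zero _ _) (zpow_ne_zero _ hk)

theorem sigma_ne_zero {n : ℤ} {x : ℝ × ℝ} {m : ℂ} (hm : m ≠ 0) : sigma n x m ≠ 0 := by
  rw [sigma_eq]; exact mul_ne_zero (zpow_ne_zero _ (neg_ne_zero.2 hm)) (wave_ne_zero _ _)

theorem rho_add_one {n : ℤ} {x : ℝ × ℝ} {k : ℂ} (hk : k ≠ 0) :
    rho (n + 1) x k = rho n x k * k := by
  rw [rho_eq, rho_eq, zpow_add_one₀ hk, mul_assoc]

theorem sigma_eq_sigma_add_one {n : ℤ} {x : ℝ × ℝ} {m : ℂ} (hm : m ≠ 0) :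
    sigma n x m = -m * sigma (n + 1) x m := by
  rw [sigma_eq, sigma_eq, ← mul_assoc, ← zpow_one_add₀ (neg_ne_zero.2 hm)]
  congr 2; ring

theorem c_zero (k : ℂ) : c k 0 = 1 := zpow_zero k

theorem c_neg_one (k : ℂ) : c k (-1) = k⁻¹ := zpow_neg_one k

theorem c_add_one {k : ℂ} (hk : k ≠ 0) (i : ℤ) : c k (i + 1) = c k i * k := zpow_add_one₀ hk i

theorem c_sub_one {k : ℂ} (hk : k ≠ 0) (i : ℤ) : c k (i - 1) = c k i * k⁻¹ := zpow_sub_one₀ hk i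

theorem measurable_neg_zpow (n : ℤ) : Measurable (fun m : ℂ => (-m) ^ (-n)) := by fun_prop

theorem measurable_c (j : ℤ) : Measurable (fun m : ℂ => c m j) := by
  unfold c; fun_prop

theorem measurable_Omega (k : ℂ) : Measurable (Omega k) := by
  unfold Omega; fun_prop

theorem measurable_sigma (n : ℤ) (x : ℝ × ℝ) : Measurable (sigma n x) := by
  rw [show sigma n x = fun m => (-m) ^ (-n) * wave x m from funext (sigma_eq n x)]
  exact (measurable_neg_zpow n).mul (measurable_wave x)

theorem hasFDerivAt_rho (n : ℤ) (x : ℝ × ℝ) (k : ℂ) :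
    HasFDerivAt (fun y => rho n y k) (rho n x k • comb k k⁻¹) x := by
  simp only [rho_eq]
  refine ((hasFDerivAt_wave x k).mul_const (k ^ n)).congr_fderiv ?_
  ext <;> simp <;> ring

/-! ### The linear integral equation with a general right-hand side -/

/-- The function `f` solves the scalar linear integral equation with right-hand side
`ρ_n(k) a(k)`. -/
def Solves (Z : SpectralMeasure) (E : Set ℂ) (n : ℤ) (x : ℝ × ℝ) (f a : ℂ → ℂ) : Prop :=
  ∀ k ∈ E, Z.Converges (integrand n x f k) ∧
    f k + Z.integral (integrand n x f k) = rho n x k * a k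

variable {Z : SpectralMeasure} {E : Set ℂ} {n : ℤ} {x : ℝ × ℝ} {f g a a' : ℂ → ℂ}

theorem Solves.add (hf : Solves Z E n x f a) (hg : Solves Z E n x g a') :
    Solves Z E n x (fun k => f k + g k) (fun k => a k + a' k) := by
  intro k hk
  obtain ⟨h1, h2⟩ := hf k hk
  obtain ⟨h3, h4⟩ := hg k hk
  have : integrand n x (fun k => f k + g k) k =
      fun p => integrand n x f k p + integrand n x g k p := by
    ext p; simp only [integrand]; ring
  rw [this, SpectralMeasure.integral_add h1 h3]
  exact ⟨h1.add h3, by linear_combination h2 + h4⟩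

theorem Solves.const_mul (hf : Solves Z E n x f a) (r : ℂ) :
    Solves Z E n x (fun k => r * f k) (fun k => r * a k) := by
  intro k hk
  obtain ⟨h1, h2⟩ := hf k hk
  have : integrand n x (fun k => r * f k) k = fun p => r * integrand n x f k p := by
    ext p; simp only [integrand]; ring
  rw [this, SpectralMeasure.integral_const_mul]
  exact ⟨h1.const_mul r, by linear_combination r * h2⟩

theorem Solves.sub (hf : Solves Z E n x f a) (hg : Solves Z E n x g a') :
    Solves Z E n x (fun k => f k - g k) (fun k => a k - a' k) := by
  have := hf.add (hg.const_mul (-1))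
  simpa [← sub_eq_add_neg] using this

theorem Solves.unique (hZ : HomogeneousTrivial Z E n x) (hf : Solves Z E n x f a)
    (hg : Solves Z E n x g a') (h : ∀ k ∈ E, a k = a' k) : ∀ k ∈ E, f k = g k := by
  intro k hk
  have := hf.sub hg
  refine sub_eq_zero.1 (hZ (fun k => f k - g k) (fun l hl => (this l hl).1) (fun l hl => ?_) k hk)
  rw [(this l hl).2]
  change rho n x l * (a l - a' l) = 0
  rw [h l hl, sub_self, mul_zero]

/-! ### Consequences of the regularity assumptions -/

variable {X : Set (ℝ × ℝ)} {u : ℤ → ℝ × ℝ → ℂ → ℤ → ℂ}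

theorem IsSolution.solves (hu : IsSolution Z E X u) (n : ℤ) (hx : x ∈ X) (i : ℤ) :
    Solves Z E n x (fun k => u n x k i) (fun k => c k i) :=
  fun k hk => ⟨hu.converges n x hx k hk i, hu.equation n x hx k hk i⟩

/-- Measurability of `u` in `k` is not assumed; it is recovered from an integrable integrand by
dividing out the almost everywhere nonzero kernel at one fixed `k ∈ E`. -/
theorem IsSolution.aestronglyMeasurable (hE : IsSpectralSet Z E) (hu : IsSolution Z E X u)
    (n : ℤ) (hx : x ∈ X) (i : ℤ) :
    AEStronglyMeasurable (fun p => Z.w p * u n x p.1 i) (Z.μ.restrict Z.D) := by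
  rcases E.eq_empty_or_nonempty with hE0 | ⟨k, hk⟩
  · have : Z.D = ∅ := by
      refine Set.eq_empty_of_forall_notMem fun p hp => ?_
      have := hE.fst_mem p hp
      simp [hE0] at this
    rw [this, Measure.restrict_empty]
    exact aestronglyMeasurable_zero_measure _
  · have h1 := (hu.converges n x hx k hk i).aestronglyMeasurable
    have h2 : Measurable (fun m => (rho n x k * Omega k m * sigma n x m)⁻¹) :=
      (((measurable_Omega k).const_mul _).mul (measurable_sigma n x)).inv
    refine (h1.mul (h2.comp measurable_snd).aestronglyMeasurable).congr ?_
    filter_upwards [hE.snd_ne_zero, hE.add_ne_zero k hk] with p hp1 hp2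
    have h3 : rho n x k * Omega k p.2 * sigma n x p.2 ≠ 0 :=
      mul_ne_zero (mul_ne_zero (rho_ne_zero (hE.ne_zero k hk)) (one_div_ne_zero hp2))
        (sigma_ne_zero hp1)
    simp only [Pi.mul_apply, integrand, Function.comp]
    rw [mul_assoc, mul_right_comm, mul_inv_cancel₀ h3, one_mul]

theorem converges_potential (hE : IsSpectralSet Z E) (hu : IsSolution Z E X u)
    (hreg : IsRegular Z E X u) (n : ℤ) (hx : x ∈ X) (i j : ℤ) :
    Z.Converges (fun p => u n x p.1 i * c p.2 j * sigma n x p.2) := by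
  obtain ⟨N, hN, b, hb, -, hc⟩ := hreg.dominated n i x hx
  have hxN := mem_of_mem_nhds hN
  simp only [mul_assoc] at hc ⊢
  exact Converges.mono (f := fun l => u n x l i) (h := fun m => c m j * sigma n x m)
    (hu.aestronglyMeasurable hE n hx i) ((measurable_c j).mul (measurable_sigma n x))
    (fun p hp => (hb x hxN _ (hE.fst_mem p hp)).1) (hc x hxN j)

/-! ### Shifts of the discrete variable -/

/-- Since `k Ω - 1 = -m Ω`, one has `ρ_{n+1} Ω σ_{n+1} - ρ_n σ_{n+1} = ρ_n Ω σ_n`; the subtracted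
term integrates to the potential. -/
theorem solves_shift (hE : IsSpectralSet Z E) (hu : IsSolution Z E X u)
    (hreg : IsRegular Z E X u) (n : ℤ) (hx : x ∈ X) (i : ℤ) :
    Solves Z E n x (fun k => u (n + 1) x k i)
      (fun k => c k (i + 1) - potential Z u (n + 1) x i 0) := by
  intro k hk
  have hk0 := hE.ne_zero k hk
  have h1 := hu.converges (n + 1) x hx k hk i
  have h2 := (converges_potential hE hu hreg (n + 1) hx i 0).const_mul (rho n x k)
  have h3 : ∀ᵐ p ∂(Z.μ.restrict Z.D), integrand (n + 1) x (fun l => u (n + 1) x l i) k p -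
      rho n x k * (u (n + 1) x p.1 i * c p.2 0 * sigma (n + 1) x p.2) =
      integrand n x (fun l => u (n + 1) x l i) k p := by
    filter_upwards [hE.snd_ne_zero, hE.add_ne_zero k hk] with p hp1 hp2
    simp only [integrand, rho_add_one hk0, sigma_eq_sigma_add_one (n := n) hp1, c_zero, Omega]
    field_simp
    ring
  refine ⟨(h1.sub h2).congr h3, ?_⟩
  rw [← integral_congr h3, SpectralMeasure.integral_sub h1 h2, SpectralMeasure.integral_const_mul]
  beta_reduce
  rw [c_add_one hk0]
  have := hu.equation (n + 1) x hx k hk i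
  rw [rho_add_one hk0] at this
  change _ + (_ - rho n x k * potential Z u (n + 1) x i 0) = _
  linear_combination this

theorem solution_shift (hE : IsSpectralSet Z E) (hZ : ∀ n : ℤ, ∀ x ∈ X, HomogeneousTrivial Z E n x)
    (hu : IsSolution Z E X u) (hreg : IsRegular Z E X u) (n : ℤ) (hx : x ∈ X) (i : ℤ) :
    ∀ k ∈ E, u (n + 1) x k i =
      u n x k (i + 1) - potential Z u (n + 1) x i 0 * u n x k 0 :=
  (solves_shift hE hu hreg n hx i).unique (hZ n x hx)
    ((hu.solves n hx (i + 1)).sub ((hu.solves n hx 0).const_mul _))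
    (fun k _ => by rw [c_zero, mul_one])

/-- This is `solution_shift` integrated against `c_j σ_n`; the sign and the index `j + 1` come from
`σ_n = -m σ_{n+1}`. -/
theorem potential_shift (hE : IsSpectralSet Z E)
    (hZ : ∀ n : ℤ, ∀ x ∈ X, HomogeneousTrivial Z E n x)
    (hu : IsSolution Z E X u) (hreg : IsRegular Z E X u) (n : ℤ) (hx : x ∈ X) (i j : ℤ) :
    -potential Z u (n + 1) x i (j + 1) =
      potential Z u n x (i + 1) j - potential Z u (n + 1) x i 0 * potential Z u n x 0 j := by
  have h1 := converges_potential hE hu hreg n hx (i + 1) j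
  have h2 := (converges_potential hE hu hreg n hx 0 j).const_mul (potential Z u (n + 1) x i 0)
  have h3 : ∀ᵐ p ∂(Z.μ.restrict Z.D),
      -1 * (u (n + 1) x p.1 i * c p.2 (j + 1) * sigma (n + 1) x p.2) =
        u n x p.1 (i + 1) * c p.2 j * sigma n x p.2 -
        potential Z u (n + 1) x i 0 * (u n x p.1 0 * c p.2 j * sigma n x p.2) := by
    filter_upwards [hE.snd_ne_zero, Z.ae_mem] with p hp1 hp
    rw [solution_shift hE hZ hu hreg n hx i _ (hE.fst_mem p hp), sigma_eq_sigma_add_one (n := n) hp1,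
      c_add_one hp1]
    ring
  have h4 := integral_congr h3
  rw [SpectralMeasure.integral_sub h1 h2, SpectralMeasure.integral_const_mul,
    SpectralMeasure.integral_const_mul, neg_one_mul] at h4
  exact h4

/-! ### Continuous flows -/

/-- The times bring down `(k + m) Ω = 1` and `(k⁻¹ + m⁻¹) Ω = k⁻¹ m⁻¹`, so differentiating the
kernel leaves separable terms. The bound on `v` lets `b` dominate the directional derivative. -/
theorem solves_fderiv (hX : IsOpen X) (hE : IsSpectralSet Z E) (hu : IsSolution Z E X u)
    (hreg : IsRegular Z E X u) (n : ℤ) (hx : x ∈ X) (i : ℤ) {v : ℝ × ℝ} (hv : ‖v‖ ≤ 1) :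
    Solves Z E n x (fun k => fderiv ℝ (fun y => u n y k i) x v)
      (fun k => v.1 * (c k (i + 1) - potential Z u n x i 0) +
        v.2 * (c k (i - 1) - potential Z u n x i (-1) * c k (-1))) := by
  intro k hk
  have hk0 := hE.ne_zero k hk
  obtain ⟨N, hN, b, hb, hcK, hcU⟩ := hreg.dominated n i x hx
  have hNx := mem_of_mem_nhds hN
  set h : ℂ → ℂ := fun m => Omega k m * (-m) ^ (-n) with hh
  have hhm : Measurable h := (measurable_Omega k).mul (measurable_neg_zpow n)
  have hcb : ∀ y ∈ N, Z.Converges (fun p => (b p.1 : ℂ) * (h p.2 * wave y p.2)) := by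
    intro y hy
    refine ((hcK y hy k hk).const_mul (rho n y k)⁻¹).congr (ae_of_all _ fun p => ?_)
    have := rho_ne_zero (n := n) (x := y) hk0
    simp only [integrand, hh, sigma_eq]
    field_simp
  obtain ⟨hdm, T, hT, hTv⟩ := hasFDerivAt_integral_wave hE.fst_mem (f := fun y l => u n y l i)
    hhm (inter_mem hN (hX.mem_nhds hx)) (b := b)
    (fun y hy => hu.aestronglyMeasurable hE n hy.2 i)
    (fun y hy l hl => (hreg.differentiable n l hl i).differentiableAt (hX.mem_nhds hy.2))
    (fun y hy => hb y hy.1) (fun y hy => by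
      refine ⟨hcb y hy.1, ?_, ?_⟩
      -- Here `m Ω = 1 - k Ω`; the next case uses `m⁻¹ Ω = k⁻¹ (m⁻¹ - Ω)`.
      · refine ((hcU y hy.1 0).sub ((hcb y hy.1).const_mul k)).congr ?_
        filter_upwards [hE.add_ne_zero k hk] with p hp
        simp only [hh, c_zero, sigma_eq, Omega]
        field_simp
        ring
      · refine (((hcU y hy.1 (-1)).sub (hcb y hy.1)).const_mul k⁻¹).congr ?_
        filter_upwards [hE.snd_ne_zero, hE.add_ne_zero k hk] with p hp0 hp
        simp only [hh, c_neg_one, sigma_eq, Omega]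
        generalize (-p.2) ^ (-n) = q
        field_simp
        ring)
  have hint : ∀ f : ℂ → ℂ, ∀ y, integrand n y f k =
      fun p => rho n y k * (f p.1 * (h p.2 * wave y p.2)) := by
    intro f y; ext p; simp only [integrand, hh, sigma_eq]; ring
  have hd : Z.Converges (fun p => fderiv ℝ (fun y => u n y p.1 i) x v * (h p.2 * wave x p.2)) :=
    Converges.mono (f := fun l => fderiv ℝ (fun y => u n y l i) x v)
      (h := fun m => h m * wave x m) (hdm v) (hhm.mul (measurable_wave x))
      (fun p hp => (ContinuousLinearMap.unit_le_opNorm _ v hv).trans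
        (hb x hNx _ (hE.fst_mem p hp)).2) (hcb x hNx)
  have hu0 : Z.Converges (fun p => u n x p.1 i * (h p.2 * wave x p.2)) :=
    Converges.mono (f := fun l => u n x l i)
      (h := fun m => h m * wave x m) (hu.aestronglyMeasurable hE n hx i)
      (hhm.mul (measurable_wave x))
      (fun p hp => (hb x hNx _ (hE.fst_mem p hp)).1) (hcb x hNx)
  refine ⟨by rw [hint]; exact hd.const_mul _, ?_⟩
  rw [hint, SpectralMeasure.integral_const_mul]
  have hA := (converges_potential hE hu hreg n hx i 0).const_mul (v.1 : ℂ)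
  have hB := (converges_potential hE hu hreg n hx i (-1)).const_mul (v.2 * k⁻¹)
  have hC := hu0.const_mul (comb k k⁻¹ v)
  have hTv' : T v = Z.integral (fun p =>
      fderiv ℝ (fun y => u n y p.1 i) x v * (h p.2 * wave x p.2)) +
      ((v.1 * potential Z u n x i 0 + v.2 * k⁻¹ * potential Z u n x i (-1)) -
        comb k k⁻¹ v * Z.integral (fun p => u n x p.1 i * (h p.2 * wave x p.2))) := by
    rw [hTv]
    simp only [potential, ← SpectralMeasure.integral_const_mul]
    rw [← SpectralMeasure.integral_add hA hB, ← SpectralMeasure.integral_sub (hA.add hB) hC,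
      ← SpectralMeasure.integral_add hd ((hA.add hB).sub hC)]
    refine integral_congr ?_
    filter_upwards [hE.snd_ne_zero, hE.add_ne_zero k hk] with p hp0 hp
    simp only [hh, c_neg_one, c_zero, sigma_eq, Omega, comb_apply]
    generalize (-p.2) ^ (-n) = q
    field_simp
    ring
  -- The equation gives `u` as `ρ_n` times `c` minus an integral; the product rule is applied to
  -- that expression.
  have hfd : HasFDerivAt (fun y => u n y k i) (rho n x k • -T +
      (c k i - Z.integral (fun p => u n x p.1 i * (h p.2 * wave x p.2))) •
        (rho n x k • comb k k⁻¹)) x := by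
    refine ((hasFDerivAt_rho n x k).mul (hT.const_sub (c k i))).congr_of_eventuallyEq ?_
    filter_upwards [hX.mem_nhds hx] with y hy
    have := hu.equation n y hy k hk i
    rw [hint, SpectralMeasure.integral_const_mul] at this
    simp only [Pi.mul_apply]
    linear_combination this
  beta_reduce
  rw [hfd.fderiv]
  simp only [add_apply, smul_apply, neg_apply, hTv', smul_eq_mul, comb_apply,
    c_add_one hk0, c_sub_one hk0, c_neg_one]
  ring

theorem hasFDerivAt_solution (hX : IsOpen X) (hE : IsSpectralSet Z E)
    (hZ : ∀ n : ℤ, ∀ x ∈ X, HomogeneousTrivial Z E n x)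
    (hu : IsSolution Z E X u) (hreg : IsRegular Z E X u) (n : ℤ) (hx : x ∈ X) (i : ℤ)
    {k : ℂ} (hk : k ∈ E) :
    HasFDerivAt (fun y => u n y k i)
      (comb (u n x k (i + 1) - potential Z u n x i 0 * u n x k 0)
        (u n x k (i - 1) - potential Z u n x i (-1) * u n x k (-1))) x := by
  have key : ∀ v : ℝ × ℝ, ‖v‖ ≤ 1 → fderiv ℝ (fun y => u n y k i) x v =
      v.1 * (u n x k (i + 1) - potential Z u n x i 0 * u n x k 0) +
        v.2 * (u n x k (i - 1) - potential Z u n x i (-1) * u n x k (-1)) := by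
    intro v hv
    refine (solves_fderiv hX hE hu hreg n hx i hv).unique (hZ n x hx)
      ((((hu.solves n hx (i + 1)).sub ((hu.solves n hx 0).const_mul _)).const_mul _).add
        (((hu.solves n hx (i - 1)).sub ((hu.solves n hx (-1)).const_mul _)).const_mul _))
      (fun k _ => ?_) k hk
    rw [c_zero, mul_one]
  have h := ((hreg.differentiable n k hk i).differentiableAt (hX.mem_nhds hx)).hasFDerivAt
  rw [eq_comb (fderiv ℝ (fun y => u n y k i) x), key (1, 0) (by simp [Prod.norm_def]),
    key (0, 1) (by simp [Prod.norm_def])] at h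
  simpa using h

theorem hasFDerivAt_potential (hX : IsOpen X) (hE : IsSpectralSet Z E)
    (hZ : ∀ n : ℤ, ∀ x ∈ X, HomogeneousTrivial Z E n x)
    (hu : IsSolution Z E X u) (hreg : IsRegular Z E X u) (n : ℤ) (hx : x ∈ X) (i j : ℤ) :
    HasFDerivAt (fun y => potential Z u n y i j)
      (comb (potential Z u n x (i + 1) j - potential Z u n x i 0 * potential Z u n x 0 j +
          potential Z u n x i (j + 1))
        (potential Z u n x (i - 1) j - potential Z u n x i (-1) * potential Z u n x (-1) j +
          potential Z u n x i (j - 1))) x := by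
  obtain ⟨N, hN, b, hb, -, hcU⟩ := hreg.dominated n i x hx
  set h : ℂ → ℂ := fun m => c m j * (-m) ^ (-n) with hh
  have hhm : Measurable h := (measurable_c j).mul (measurable_neg_zpow n)
  obtain ⟨-, T, hT, hTv⟩ := hasFDerivAt_integral_wave hE.fst_mem (f := fun y l => u n y l i)
    hhm (inter_mem hN (hX.mem_nhds hx)) (b := b)
    (fun y hy => hu.aestronglyMeasurable hE n hy.2 i)
    (fun y hy l hl => (hreg.differentiable n l hl i).differentiableAt (hX.mem_nhds hy.2))
    (fun y hy => hb y hy.1) (fun y hy => by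
      refine ⟨(hcU y hy.1 j).congr (ae_of_all _ fun p => ?_), (hcU y hy.1 (j + 1)).congr ?_,
        (hcU y hy.1 (j - 1)).congr ?_⟩
      · simp only [hh, sigma_eq]; ring
      · filter_upwards [hE.snd_ne_zero] with p hp
        simp only [hh, sigma_eq, c_add_one hp]; ring
      · filter_upwards [hE.snd_ne_zero] with p hp
        simp only [hh, sigma_eq, c_sub_one hp]; ring)
  have hfun : (fun y => potential Z u n y i j) =
      fun y => Z.integral (fun p => u n y p.1 i * (h p.2 * wave y p.2)) := by
    ext y
    simp only [potential, hh, sigma_eq, mul_assoc]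
  rw [hfun]
  refine hT.congr_fderiv (ContinuousLinearMap.ext fun v => ?_)
  have hP := fun i j => converges_potential hE hu hreg n hx i j
  have hA := (((hP (i + 1) j).sub ((hP 0 j).const_mul (potential Z u n x i 0))).add
    (hP i (j + 1))).const_mul (v.1 : ℂ)
  have hB := (((hP (i - 1) j).sub ((hP (-1) j).const_mul (potential Z u n x i (-1)))).add
    (hP i (j - 1))).const_mul (v.2 : ℂ)
  have h1 := SpectralMeasure.integral_add hA hB
  rw [SpectralMeasure.integral_const_mul, SpectralMeasure.integral_const_mul,
    SpectralMeasure.integral_add ((hP (i + 1) j).sub ((hP 0 j).const_mul _)) (hP i (j + 1)),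
    SpectralMeasure.integral_add ((hP (i - 1) j).sub ((hP (-1) j).const_mul _)) (hP i (j - 1)),
    SpectralMeasure.integral_sub (hP (i + 1) j) ((hP 0 j).const_mul _),
    SpectralMeasure.integral_sub (hP (i - 1) j) ((hP (-1) j).const_mul _),
    SpectralMeasure.integral_const_mul, SpectralMeasure.integral_const_mul] at h1
  rw [hTv, comb_apply, mul_comm _ (v.1 : ℂ), mul_comm _ (v.2 : ℂ)]
  refine Eq.trans (integral_congr ?_) h1
  filter_upwards [hE.snd_ne_zero, Z.ae_mem] with p hp0 hp
  rw [(hasFDerivAt_solution hX hE hZ hu hreg n hx i (hE.fst_mem p hp)).fderiv]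
  simp only [hh, sigma_eq, comb_apply, c_add_one hp0, c_sub_one hp0]
  ring

/-- The first derivatives are polynomials in the entries of the same matrix, so regularity
bootstraps for all entries at once. -/
theorem contDiffOn_potential (hX : IsOpen X) (hE : IsSpectralSet Z E)
    (hZ : ∀ n : ℤ, ∀ x ∈ X, HomogeneousTrivial Z E n x)
    (hu : IsSolution Z E X u) (hreg : IsRegular Z E X u) (r : ℕ) (n i j : ℤ) :
    ContDiffOn ℝ r (fun y => potential Z u n y i j) X := by
  have hd := fun i j y (hy : y ∈ X) => hasFDerivAt_potential hX hE hZ hu hreg n hy i j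
  induction r generalizing i j with
  | zero =>
    exact contDiffOn_zero.2 fun y hy => (hd i j y hy).continuousAt.continuousWithinAt
  | succ r ih =>
    rw [Nat.cast_succ, contDiffOn_succ_iff_fderiv_of_isOpen hX]
    refine ⟨fun y hy => (hd i j y hy).differentiableAt.differentiableWithinAt, by simp, ?_⟩
    refine ContDiffOn.congr ?_ fun y hy => (hd i j y hy).fderiv
    refine ((((ih _ _).sub ((ih _ _).mul (ih _ _))).add (ih _ _)).smul contDiffOn_const).add
      ((((ih _ _).sub ((ih _ _).mul (ih _ _))).add (ih _ _)).smul contDiffOn_const)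

/-! ### Branches of the logarithm -/

theorem IsLogNear.eventually {g φ : ℝ × ℝ → ℂ} (h : IsLogNear g φ x) :
    ∀ᶠ y in 𝓝 x, IsLogNear g φ y := eventually_eventually_nhds.2 h

theorem IsLogNear.ne_zero {g φ : ℝ × ℝ → ℂ} (h : IsLogNear g φ x) : g x ≠ 0 := by
  rw [← (Eventually.self_of_nhds h).2]
  exact Complex.exp_ne_zero _

/-- Dividing by `g x` brings the argument near `1`; continuity keeps the imaginary part of `φ y - φ
x` in `(-π, π)`, which excludes multiples of `2πi`. -/
theorem IsLogNear.eventuallyEq {g φ : ℝ × ℝ → ℂ} (h : IsLogNear g φ x) :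
    φ =ᶠ[𝓝 x] fun y => Complex.log (g y * (g x)⁻¹) + φ x := by
  obtain ⟨hc, he⟩ := Eventually.self_of_nhds h
  have him : Tendsto (fun y => (φ y - φ x).im) (𝓝 x) (𝓝 0) := by
    have : Tendsto (fun y => (φ y - φ x).im) (𝓝 x) (𝓝 (φ x - φ x).im) :=
      (Complex.continuous_im.tendsto _).comp (hc.tendsto.sub_const (φ x))
    simpa using this
  filter_upwards [h, him.eventually (Ioo_mem_nhds (neg_lt_zero.2 Real.pi_pos) Real.pi_pos)]
    with y hy hy'
  rw [← hy.2, ← he, ← Complex.exp_neg, ← Complex.exp_add, ← sub_eq_add_neg,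
    Complex.log_exp hy'.1 hy'.2.le, sub_add_cancel]

theorem IsLogNear.contDiffAt {g φ : ℝ × ℝ → ℂ} (h : IsLogNear g φ x) {r : WithTop ℕ∞}
    (hg : ContDiffAt ℝ r g x) : ContDiffAt ℝ r φ x := by
  refine ContDiffAt.congr_of_eventuallyEq ?_ h.eventuallyEq
  refine ContDiffAt.add (ContDiffAt.comp x (g := Complex.log) (f := fun y => g y * (g x)⁻¹) ?_
    (hg.mul contDiffAt_const)) contDiffAt_const
  refine (Complex.contDiffAt_log ?_).restrict_scalars ℝ
  rw [mul_inv_cancel₀ h.ne_zero]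
  exact Complex.one_mem_slitPlane

theorem IsLogNear.hasFDerivAt {g φ : ℝ × ℝ → ℂ} (h : IsLogNear g φ x) {A B : ℂ}
    (hg : HasFDerivAt g (comb (A * g x) (B * g x)) x) : HasFDerivAt φ (comb A B) x := by
  have h0 := h.ne_zero
  refine HasFDerivAt.congr_of_eventuallyEq ?_ h.eventuallyEq
  have hslit : g x * (g x)⁻¹ ∈ Complex.slitPlane := by
    rw [mul_inv_cancel₀ h0]
    exact Complex.one_mem_slitPlane
  have hlog := (Complex.hasStrictDerivAt_log hslit).hasDerivAt.hasFDerivAt.restrictScalars ℝ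
  refine ((hlog.comp x (hg.mul_const (g x)⁻¹)).add_const (φ x)).congr_fderiv ?_
  ext <;> simp [h0] <;> field_simp

theorem exists_isLogNear {g : ℝ × ℝ → ℂ} (hX : IsOpen X) (hg : ContinuousOn g X) (hx : x ∈ X)
    (h0 : ∀ y ∈ X, g y ≠ 0) : ∃ φ, IsLogNear g φ x := by
  have hgx := h0 x hx
  have hat : ∀ y ∈ X, ContinuousAt (fun y => g y * (g x)⁻¹) y := fun y hy =>
    (hg.continuousAt (hX.mem_nhds hy)).mul continuousAt_const
  refine ⟨fun y => Complex.log (g y * (g x)⁻¹) + Complex.log (g x), ?_⟩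
  have hs : ∀ᶠ y in 𝓝 x, g y * (g x)⁻¹ ∈ Complex.slitPlane := by
    refine (hat x hx).eventually_mem (Complex.isOpen_slitPlane.mem_nhds ?_)
    rw [mul_inv_cancel₀ hgx]
    exact Complex.one_mem_slitPlane
  filter_upwards [hs, hX.mem_nhds hx] with y hy hyX
  refine ⟨((hat y hyX).clog hy).add continuousAt_const, ?_⟩
  rw [Complex.exp_add, Complex.exp_log (Complex.slitPlane_ne_zero hy), Complex.exp_log hgx,
    inv_mul_cancel_right₀ hgx]

theorem partialOne_eq {F : ℝ × ℝ → ℂ} {T : ℝ × ℝ →L[ℝ] ℂ} (h : HasFDerivAt F T x) :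
    partialOne F x = T (1, 0) :=
  (h.comp_hasDerivAt x.1
    (HasDerivAt.prodMk (hasDerivAt_id x.1) (hasDerivAt_const x.1 x.2))).deriv

theorem partialNegOne_eq {F : ℝ × ℝ → ℂ} {T : ℝ × ℝ →L[ℝ] ℂ} (h : HasFDerivAt F T x) :
    partialNegOne F x = T (0, 1) :=
  (h.comp_hasDerivAt x.2
    (HasDerivAt.prodMk (hasDerivAt_const x.2 x.1) (hasDerivAt_id x.2))).deriv

/-! ### The Lax matrices -/

theorem infMulVec_laxP (φ : ℤ → ℝ × ℝ → ℂ) (x : ℝ × ℝ) (v : ℤ → ℂ) (n : ℤ) :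
    infMulVec (laxP φ x) v n = partialOne (φ n) x * v n + v (n + 1) := by
  rw [infMulVec, tsum_eq_sum (s := {n, n + 1})]
  · rw [Finset.sum_pair (by omega)]
    simp [laxP]
  · intro m hm
    simp only [Finset.mem_insert, Finset.mem_singleton, not_or] at hm
    simp [laxP, hm.1, hm.2]

theorem infMulVec_laxQ (φ : ℤ → ℝ × ℝ → ℂ) (x : ℝ × ℝ) (v : ℤ → ℂ) (n : ℤ) :
    infMulVec (laxQ φ x) v n = Complex.exp (-theta φ n x) * v (n - 1) := by
  rw [infMulVec, tsum_eq_single (n - 1)]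
  · simp [laxQ]
  · intro m hm
    simp [laxQ, hm]

/-! ### The Toda lattice -/

/-- The function `1 - U_n^{(0,-1)}` has an explicit inverse. -/
theorem one_sub_potential_mul (hE : IsSpectralSet Z E)
    (hZ : ∀ n : ℤ, ∀ x ∈ X, HomogeneousTrivial Z E n x)
    (hu : IsSolution Z E X u) (hreg : IsRegular Z E X u) (n : ℤ) (hx : x ∈ X) :
    (1 - potential Z u n x 0 (-1)) * (1 - potential Z u (n + 1) x (-1) 0) = 1 := by
  have := potential_shift hE hZ hu hreg n hx (-1) (-1)
  norm_num at this
  linear_combination this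

/-- The flow of `U_n^{(0,-1)}` involves `U_n^{(1,-1)}` and `U_n^{(0,-2)}`. The shift relations at
`(0,-1)` and `(-1,-2)` eliminate them, the second with the help of the inverse formula. -/
theorem hasFDerivAt_one_sub_potential (hX : IsOpen X) (hE : IsSpectralSet Z E)
    (hZ : ∀ n : ℤ, ∀ x ∈ X, HomogeneousTrivial Z E n x)
    (hu : IsSolution Z E X u) (hreg : IsRegular Z E X u) (n : ℤ) (hx : x ∈ X) :
    HasFDerivAt (fun y => 1 - potential Z u n y 0 (-1))
      (comb ((potential Z u (n + 1) x 0 0 - potential Z u n x 0 0) *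
          (1 - potential Z u n x 0 (-1)))
        ((potential Z u (n + 1) x (-1) (-1) - potential Z u n x (-1) (-1)) *
          (1 - potential Z u n x 0 (-1)))) x := by
  have h0 := one_sub_potential_mul hE hZ hu hreg n hx
  have h1 := potential_shift hE hZ hu hreg n hx 0 (-1)
  have h2 := potential_shift hE hZ hu hreg n hx (-1) (-2)
  norm_num at h1 h2
  refine ((hasFDerivAt_potential hX hE hZ hu hreg n hx 0 (-1)).const_sub 1).congr_fderiv ?_
  ext
  · norm_num
    linear_combination h1
  · norm_num
    linear_combination (1 - potential Z u n x 0 (-1)) * h2 +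
      potential Z u n x 0 (-2) * h0

/-- The Riccati form factors: `∂_1 U_n^{(-1,-1)} = 1 - (1 - U_n^{(0,-1)})(1 - U_n^{(-1,0)})`, and
the last factor is the inverse of `1 - U_{n-1}^{(0,-1)}`. -/
theorem partialOne_potential_sub (hX : IsOpen X) (hE : IsSpectralSet Z E)
    (hZ : ∀ n : ℤ, ∀ x ∈ X, HomogeneousTrivial Z E n x)
    (hu : IsSolution Z E X u) (hreg : IsRegular Z E X u) (n : ℤ) (hx : x ∈ X) :
    partialOne (fun y => potential Z u (n + 1) y (-1) (-1) - potential Z u n y (-1) (-1)) x =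
      (1 - potential Z u n x 0 (-1)) / (1 - potential Z u (n - 1) x 0 (-1)) -
        (1 - potential Z u (n + 1) x 0 (-1)) / (1 - potential Z u n x 0 (-1)) := by
  have h0 := one_sub_potential_mul hE hZ hu hreg n hx
  have h1 := one_sub_potential_mul hE hZ hu hreg (n - 1) hx
  rw [sub_add_cancel] at h1
  have hd := fun n => hasFDerivAt_potential hX hE hZ hu hreg n hx (-1) (-1)
  refine (partialOne_eq ((hd (n + 1)).sub (hd n))).trans ?_
  rw [div_eq_mul_inv, div_eq_mul_inv, inv_eq_of_mul_eq_one_right h0,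
    inv_eq_of_mul_eq_one_right h1]
  simp
  ring

end Toda

theorem theorem1 (Z : Toda.SpectralMeasure) (E : Set ℂ) (hE : Toda.IsSpectralSet Z E)
    (X : Set (ℝ × ℝ)) (hX : IsOpen X)
    (hZ : ∀ n : ℤ, ∀ x ∈ X, Toda.HomogeneousTrivial Z E n x)
    (u : ℤ → ℝ × ℝ → ℂ → ℤ → ℂ) (hu : Toda.IsSolution Z E X u) (hreg : Toda.IsRegular Z E X u) :
    (∀ n : ℤ, ∀ x ∈ X, 1 - Toda.potential Z u n x 0 (-1) ≠ 0) ∧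
    (∀ x ∈ X, ∃ φ : ℤ → ℝ × ℝ → ℂ,
      ∀ n : ℤ, Toda.IsLogNear (fun y => 1 - Toda.potential Z u n y 0 (-1)) (φ n) x) ∧
    ∀ x ∈ X, ∀ φ : ℤ → ℝ × ℝ → ℂ,
      (∀ n : ℤ, Toda.IsLogNear (fun y => 1 - Toda.potential Z u n y 0 (-1)) (φ n) x) →
      (∀ n : ℤ, ContDiffAt ℝ 2 (φ n) x ∧
        Toda.partialOne (Toda.partialNegOne (φ n)) x =
          Complex.exp (φ n x - φ (n - 1) x) - Complex.exp (φ (n + 1) x - φ n x)) ∧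
      ∀ k ∈ E,
        (∀ n : ℤ, DifferentiableAt ℝ (fun y => u n y k 0) x) ∧
        (fun n : ℤ => Toda.partialOne (fun y => u n y k 0) x) =
          Toda.infMulVec (Toda.laxP φ x) (fun n => u n x k 0) ∧
        (fun n : ℤ => Toda.partialNegOne (fun y => u n y k 0) x) =
          Toda.infMulVec (Toda.laxQ φ x) (fun n => u n x k 0) := by
  have hne : ∀ n : ℤ, ∀ x ∈ X, 1 - Toda.potential Z u n x 0 (-1) ≠ 0 := fun n x hx =>
    left_ne_zero_of_mul_eq_one (Toda.one_sub_potential_mul hE hZ hu hreg n hx)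
  have hv := fun n x (hx : x ∈ X) => Toda.hasFDerivAt_one_sub_potential hX hE hZ hu hreg n hx
  refine ⟨hne, fun x hx => ?_, fun x hx φ hφ => ⟨fun n => ⟨?_, ?_⟩, fun k hk => ?_⟩⟩
  · choose φ hφ using fun n : ℤ => Toda.exists_isLogNear hX
      (fun y hy => (hv n y hy).continuousAt.continuousWithinAt) hx (hne n)
    exact ⟨φ, hφ⟩
  · exact (hφ n).contDiffAt (contDiffAt_const.sub
      ((Toda.contDiffOn_potential hX hE hZ hu hreg 2 n 0 (-1)).contDiffAt (hX.mem_nhds hx)))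
  -- The identity is needed on a neighbourhood because it is differentiated again.
  · have hev : Toda.partialNegOne (φ n) =ᶠ[𝓝 x] fun y =>
        Toda.potential Z u (n + 1) y (-1) (-1) - Toda.potential Z u n y (-1) (-1) := by
      filter_upwards [(hφ n).eventually, hX.mem_nhds hx] with y hy hyX
      exact (Toda.partialNegOne_eq (hy.hasFDerivAt (hv n y hyX))).trans (by simp)
    have hline : Tendsto (fun s : ℝ => (s, x.2)) (𝓝 x.1) (𝓝 x) :=
      (Continuous.prodMk_left x.2).tendsto x.1
    have he : ∀ m, Complex.exp (φ m x) = 1 - Toda.potential Z u m x 0 (-1) := fun m =>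
      (Eventually.self_of_nhds (hφ m)).2
    rw [Complex.exp_sub, Complex.exp_sub, he, he, he,
      ← Toda.partialOne_potential_sub hX hE hZ hu hreg n hx]
    exact Filter.EventuallyEq.deriv_eq (hline.eventually hev)
  · have hd := fun n => Toda.hasFDerivAt_solution hX hE hZ hu hreg n hx 0 hk
    have he : ∀ m, Complex.exp (φ m x) = 1 - Toda.potential Z u m x 0 (-1) := fun m =>
      (Eventually.self_of_nhds (hφ m)).2
    refine ⟨fun n => (hd n).differentiableAt, funext fun n => ?_, funext fun n => ?_⟩
    · rw [Toda.infMulVec_laxP, Toda.partialOne_eq (hd n),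
        Toda.partialOne_eq ((hφ n).hasFDerivAt (hv n x hx)),
        Toda.solution_shift hE hZ hu hreg n hx 0 k hk]
      simp
      ring
    · rw [Toda.infMulVec_laxQ, Toda.partialNegOne_eq (hd n), Toda.theta, neg_sub, Complex.exp_sub,
        he, he]
      have h0 := Toda.one_sub_potential_mul hE hZ hu hreg (n - 1) hx
      -- At `i = -1` the shift makes `u_n^{(-1)}` a multiple of `u_{n-1}^{(0)}`, with factor the
      -- inverse of `1 - U_{n-1}^{(0,-1)}`.
      have h1 := Toda.solution_shift hE hZ hu hreg (n - 1) hx (-1) k hk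
      rw [sub_add_cancel] at h0 h1
      rw [div_eq_mul_inv, inv_eq_of_mul_eq_one_right h0]
      norm_num at h1 ⊢
      rw [h1]
      ring
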